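/- Let $\theta>0$. For $n\ge 0$ let $P_{n;\theta}$ be the Ewens distribution on the symmetric group $S_n$, that is, the probability measure with $$P_{n;\theta}(\{\sigma\})=\frac{\theta^{N^{(n)}(\sigma)}}{\theta(\theta+1)\cdots(\theta+n-1)},\qquad \sigma\in S_n,$$ where $N^{(n)}(\sigma)$ is the number of cycles of $\sigma$ (fixed points included). For $m\ge 1$ let $C^{(n)}_m(\sigma)$ be the number of cycles of length $m$ of $\sigma$. Let $(Z_{\theta/m})_{m\ge1}$ be independent random variables such that $Z_{\theta/m}$ has the Poisson distribution with parameter $\theta/m$. Then the following hold as $n\to\infty$. (1) Under $P_{n;\theta}$ the random sequence $(C^{(n)}_1,C^{(n)}_2,\ldots)$ converges weakly (in the space of sequences of nonnegative integers with the product topology) to $(Z_{\theta},Z_{\theta/2},Z_{\theta/3},\ldots)$. (2) Equivalently, for all $m\ge1$ and all integers $j_1,\ldots,j_m\ge0$, $$\lim_{n\to\infty}P_{n;\theta}\big(C^{(n)}_1=j_1,\ldots,C^{(n)}_m=j_m\big)=\prod_{k=1}^m e^{-\theta/k}\,\frac{(\theta/k)^{j_k}}{j_k!}.$$ (3) For all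 $m\ge1$ and all integers $k_1,\ldots,k_m\ge0$, the joint moments satisfy $$\lim_{n\to\infty}E_{n;\theta}\prod_{j=1}^m\big(C^{(n)}_j\big)^{k_j}=\prod_{j=1}^m T_{k_j}\!\Big(\frac{\theta}{j}\Big),$$ where $E_{n;\theta}$ is the expectation under $P_{n;\theta}$, $T_k(x)=\sum_{i=0}^k S(k,i)\,x^i$ is the $k$-th Touchard polynomial, and $S(k,i)$ is the Stirling number of the second kind (the number of partitions of a $k$-element set into $i$ nonempty blocks, with $S(0,0)=1$). -/

import Mathlib

open MeasureTheory ProbabilityTheory Filter Topology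

namespace EwensCycles

/-- The discrete sigma-algebra on the symmetric group `S_n`. -/
instance permMeasurableSpace (n : ℕ) : MeasurableSpace (Equiv.Perm (Fin n)) := ⊤

/-- `C_m^{(n)}(σ)`: the number of cycles of length `m` of `σ ∈ S_n`. The multiset
`σ.partition.parts` lists the lengths of all cycles of `σ`, a fixed point being a cycle of
length `1`. -/
def cycleCount {n : ℕ} (m : ℕ) (σ : Equiv.Perm (Fin n)) : ℕ :=
  σ.partition.parts.count m

/-- `N^{(n)}(σ)`: the total number of cycles of `σ ∈ S_n`, fixed points included. -/
def numCycles {n : ℕ} (σ : Equiv.Perm (Fin n)) : ℕ :=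
  Multiset.card σ.partition.parts

lemma numCycles_eq {n : ℕ} (σ : Equiv.Perm (Fin n)) :
    numCycles σ = Multiset.card σ.cycleType + (n - σ.support.card) := by
  simp [numCycles, Equiv.Perm.partition]

lemma numCycles_swap_mul {n : ℕ} (f : Equiv.Perm (Fin n)) {x y : Fin n} (hx : f x = x)
    (hxy : x ≠ y) : numCycles (Equiv.swap x y * f) + 1 = numCycles f := by
  have hs : ∀ g : Equiv.Perm (Fin n), g.support.card ≤ n := fun g => by
    simpa using g.support.card_le_univ
  have hsf := hs f
  have hss := hs (Equiv.swap x y * f)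
  rw [numCycles_eq, numCycles_eq]
  rw [← Equiv.Perm.sum_cycleType] at hsf hss ⊢
  rw [← Equiv.Perm.sum_cycleType f]
  by_cases hy : f y = y
  · have hd : Equiv.Perm.Disjoint (Equiv.swap x y) f := by
      intro z
      by_cases hzx : z = x
      · right; rw [hzx, hx]
      by_cases hzy : z = y
      · right; rw [hzy, hy]
      left; exact Equiv.swap_apply_of_ne_of_ne hzx hzy
    have hc : (Equiv.swap x y).cycleType = {2} :=
      Equiv.Perm.isSwap_iff_cycleType.mp ⟨x, y, hxy, rfl⟩
    rw [hd.cycleType_mul, hc] at hss ⊢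
    simp only [Multiset.sum_add, Multiset.sum_singleton, Multiset.card_add,
      Multiset.card_singleton] at hss ⊢
    omega
  · have hmem : f.cycleOf y ∈ f.cycleFactorsFinset :=
      Equiv.Perm.cycleOf_mem_cycleFactorsFinset_iff.2 (Equiv.Perm.mem_support.2 hy)
    have hd := Equiv.Perm.disjoint_mul_inv_of_mem_cycleFactorsFinset hmem
    have hsup : y ∈ f.support := Equiv.Perm.mem_support.2 hy
    have hxl : x ∉ f.toList y := by
      rw [Equiv.Perm.mem_toList_iff]
      rintro ⟨h, -⟩
      exact hy ((h.apply_eq_self_iff).2 hx)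
    have hnd : (x :: f.toList y).Nodup :=
      List.nodup_cons.2 ⟨hxl, Equiv.Perm.nodup_toList f y⟩
    have hlen : 2 ≤ (f.toList y).length :=
      Equiv.Perm.two_le_length_toList_iff_mem_support.2 hsup
    have hsw : Equiv.swap x y * f.cycleOf y = (x :: f.toList y).formPerm := by
      obtain ⟨a, l, hl⟩ : ∃ a l, f.toList y = a :: l :=
        List.exists_cons_of_length_pos (by omega)
      have ha : a = y := by
        have := Equiv.Perm.toList_getElem_zero f y hsup
        simpa [hl] using this
      rw [← Equiv.Perm.formPerm_toList, hl, ha, List.formPerm_cons_cons]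
    have hct1 : (Equiv.swap x y * f.cycleOf y).cycleType = {(f.toList y).length + 1} := by
      rw [hsw, Equiv.Perm.IsCycle.cycleType (List.isCycle_formPerm hnd (by simp; omega)),
        List.support_formPerm_of_nodup _ hnd (by
          intro z hz
          have := congrArg List.length hz
          simp at this
          simp [this] at hlen), List.toFinset_card_of_nodup hnd]
      simp
    have hct2 : (f.cycleOf y).cycleType = {(f.toList y).length} := by
      rw [Equiv.Perm.IsCycle.cycleType (Equiv.Perm.isCycle_cycleOf f hy),
        Equiv.Perm.length_toList]
    have hcx : f.cycleOf y x = x := by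
      rw [← Equiv.Perm.notMem_support, Equiv.Perm.mem_support_cycleOf_iff]
      rintro ⟨h, -⟩
      exact hy ((h.apply_eq_self_iff).2 hx)
    have hgx : (f * (f.cycleOf y)⁻¹) x = x := by
      have : (f.cycleOf y)⁻¹ x = x := Equiv.Perm.inv_eq_iff_eq.2 hcx.symm
      rw [Equiv.Perm.mul_apply, this, hx]
    have hd' : Equiv.Perm.Disjoint (Equiv.swap x y * f.cycleOf y) (f * (f.cycleOf y)⁻¹) := by
      intro z
      rcases hd z with h | h
      · exact Or.inr h
      · by_cases hzx : z = x
        · right; rw [hzx, hgx]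
        by_cases hzy : z = y
        · exfalso
          rw [hzy, Equiv.Perm.cycleOf_apply_self] at h
          exact hy h
        left
        rw [Equiv.Perm.mul_apply, h, Equiv.swap_apply_of_ne_of_ne hzx hzy]
    have hf : f = f.cycleOf y * (f * (f.cycleOf y)⁻¹) := by
      rw [hd.symm.commute.eq]; simp
    have hc1 : f.cycleType = {(f.toList y).length} + (f * (f.cycleOf y)⁻¹).cycleType := by
      conv_lhs => rw [hf]
      rw [hd.symm.cycleType_mul, hct2]
    have hc2 : (Equiv.swap x y * f).cycleType =
        {(f.toList y).length + 1} + (f * (f.cycleOf y)⁻¹).cycleType := by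
      conv_lhs => rw [hf]
      rw [← mul_assoc, hd'.cycleType_mul, hct1]
    rw [hc1] at hsf
    rw [hc2] at hss
    rw [hc1, hc2]
    simp only [Multiset.sum_add, Multiset.sum_singleton, Multiset.card_add,
      Multiset.card_singleton] at hss hsf ⊢
    omega

lemma numCycles_decomposeFin_zero {n : ℕ} (e : Equiv.Perm (Fin n)) :
    numCycles (Equiv.Perm.decomposeFin.symm (0, e)) = numCycles e + 1 := by
  have h : Equiv.Perm.decomposeFin.symm (0, e) =
      e.extendDomain (finSuccAboveEquiv (0 : Fin (n + 1))) := by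
    ext z
    refine Fin.cases ?_ (fun i => ?_) z
    · rw [Equiv.Perm.extendDomain_apply_not_subtype _ _ (by simp)]
      simp
    · have := Equiv.Perm.extendDomain_apply_image e
        (finSuccAboveEquiv (0 : Fin (n + 1))) i
      simp [finSuccAboveEquiv_apply] at this
      simp [this]
  have hs : e.support.card ≤ n := by simpa using e.support.card_le_univ
  rw [numCycles_eq, numCycles_eq]
  rw [← Equiv.Perm.sum_cycleType] at hs ⊢
  rw [← Equiv.Perm.sum_cycleType, h, Equiv.Perm.cycleType_extendDomain]
  omega

lemma numCycles_decomposeFin {n : ℕ} (p : Fin (n + 1)) (hp : p ≠ 0) (e : Equiv.Perm (Fin n)) :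
    numCycles (Equiv.Perm.decomposeFin.symm (p, e)) = numCycles e := by
  have h : Equiv.Perm.decomposeFin.symm (p, e) =
      Equiv.swap 0 p * Equiv.Perm.decomposeFin.symm (0, e) := by
    ext z
    refine Fin.cases ?_ (fun i => ?_) z <;> simp
  have := numCycles_swap_mul (Equiv.Perm.decomposeFin.symm (0, e)) (x := 0) (y := p)
    (by simp) hp.symm
  rw [numCycles_decomposeFin_zero, ← h] at this
  omega

/-- The generating function of the number of cycles over `S_n` is the rising factorial
`θ (θ + 1) ⋯ (θ + n - 1)`. -/
lemma sum_pow_numCycles (θ : ℝ) (n : ℕ) :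
    ∑ σ : Equiv.Perm (Fin n), θ ^ numCycles σ = (ascPochhammer ℝ n).eval θ := by
  induction n with
  | zero => simp [numCycles_eq]
  | succ n ih =>
    rw [← Equiv.Perm.decomposeFin.symm.sum_comp, Fintype.sum_prod_type, Fin.sum_univ_succ]
    simp only [numCycles_decomposeFin_zero, numCycles_decomposeFin _ (Fin.succ_ne_zero _),
      pow_succ, ← Finset.sum_mul, ih, ascPochhammer_succ_right]
    simp
    ring

/-- The Ewens distribution `P_{n;θ}` on `S_n`, `θ > 0`: the permutation `σ` has probability
`θ ^ N(σ) / (θ (θ + 1) ⋯ (θ + n - 1))`. -/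
noncomputable def ewens (θ : ℝ) (hθ : 0 < θ) (n : ℕ) : PMF (Equiv.Perm (Fin n)) :=
  PMF.ofFintype
    (fun σ => ENNReal.ofReal (θ ^ numCycles σ / (ascPochhammer ℝ n).eval θ)) (by
      have h : 0 < (ascPochhammer ℝ n).eval θ := ascPochhammer_pos n θ hθ
      rw [← ENNReal.ofReal_sum_of_nonneg (fun σ _ => by positivity), ← Finset.sum_div,
        sum_pow_numCycles, div_self h.ne', ENNReal.ofReal_one])

/-- The Touchard polynomial `T_k(x) = ∑_{j ≤ k} S(k, j) x ^ j`, where `S(k, j)` is the Stirling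
number of the second kind. -/
noncomputable def touchard (k : ℕ) : Polynomial ℝ :=
  ∑ j ∈ Finset.range (k + 1), Polynomial.C (Nat.stirlingSecond k j : ℝ) * Polynomial.X ^ j

end EwensCycles

/-!
The argument is a computation of factorial moments. By Cauchy's formula a cycle type with `c_k`
cycles of length `k` has Ewens weight proportional to `∏_k (θ / k) ^ c_k / c_k!`
(`sum_perm_eq_factorial_mul_partitionSum`), as if the counts were independent Poisson variables
conditioned on `∑ k c_k = n`. Removing a cycle of length `j` is a bijection from the partitions of
`n` with a part `j` onto the partitions of `n - j`. Hence, if `G` ignores cycles of length `j`, the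
mean of the falling factorial `(C_j)_r * G` on `S_n` is `(θ / j) ^ r` times the mean of `G` on
`S_{n - jr}`, times a ratio of normalizing constants (`ewensMean_descFactorial_mul`). That ratio
tends to `1` as `n → ∞` and is at most `max 1 θ⁻¹ ^ (j r)`.

A function `f` with an expansion `f c = ∑_r a_r (c)_r` whose coefficients decay faster than
geometrically can therefore be adjoined to `G` by dominated convergence: in the limit `f (C_j)`
contributes the independent factor `∑_r a_r (θ / j) ^ r` (`tendsto_ewensMean_mul`). Adjoining
`C_1, …, C_m` one at a time proves both numerical limits. For powers, `a_r` is a Stirling number of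
the second kind and the factor is a Touchard polynomial; for the indicator of `{j}`, `a_r` comes
from inclusion-exclusion and the factor is the Poisson mass at `j`.

For the weak convergence, the cylinder sets that fix the first `m` coordinates form a π-system
containing a neighbourhood basis of every point of the sequence space, so convergence of their
masses suffices.
-/

namespace EwensCycles

open scoped Nat

/-! ### From permutations to partitions -/

lemma filter_two_le_add_replicate {s : Multiset ℕ} (hs : ∀ i ∈ s, 0 < i) :
    s.filter (2 ≤ ·) + Multiset.replicate (s.count 1) 1 = s := by
  ext k
  rw [Multiset.count_add, Multiset.count_filter, Multiset.count_replicate]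
  rcases lt_trichotomy k 1 with h | rfl | h
  · have : k ∉ s := fun hk => by have := hs k hk; omega
    simp [this, h.ne']
  · simp
  · simp [show 2 ≤ k by omega, h.ne]

/-- Cauchy's formula for the number of permutations with given cycle lengths, fixed points being
parts equal to `1`. -/
lemma card_partition_eq_mul {α : Type*} [Fintype α] [DecidableEq α]
    (p : (Fintype.card α).Partition) :
    (Finset.univ.filter fun σ : Equiv.Perm α => σ.partition = p).card *
      (p.parts.prod * ∏ k ∈ p.parts.toFinset, (p.parts.count k)!) = (Fintype.card α)! := by
  have hdec := filter_two_le_add_replicate (fun i hi => p.parts_pos hi)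
  set m := p.parts.filter (2 ≤ ·) with hm
  have hsum : m.sum + p.parts.count 1 = Fintype.card α := by
    have := congrArg Multiset.sum hdec
    simpa [p.parts_sum] using this
  have hfib : ∀ σ : Equiv.Perm α, σ.partition = p ↔ σ.cycleType = m := fun σ => by
    constructor
    · rintro rfl
      exact Equiv.Perm.filter_parts_partition_eq_cycleType.symm
    · intro h
      ext1
      rw [Equiv.Perm.parts_partition, ← Equiv.Perm.sum_cycleType, h, ← hdec,
        show Fintype.card α - m.sum = p.parts.count 1 by omega]
  have hcard := Equiv.Perm.card_of_cycleType_mul_eq α m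
  rw [if_pos ⟨by omega, fun a ha => (Multiset.mem_filter.1 ha).2⟩] at hcard
  simp only [hfib]
  rw [← hcard]
  have hprod : p.parts.prod = m.prod := by
    conv_lhs => rw [← hdec]
    simp
  have hfact : ∏ k ∈ p.parts.toFinset, (p.parts.count k)! =
      (p.parts.count 1)! * ∏ k ∈ m.toFinset, (m.count k)! := by
    have h1 : (1 : ℕ) ∉ m.toFinset := by simp [hm]
    have hcount : ∀ k ∈ m.toFinset, (m.count k)! = (p.parts.count k)! := fun k hk => by
      have : 2 ≤ k := (Multiset.mem_filter.1 (Multiset.mem_toFinset.1 hk)).2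
      rw [hm, Multiset.count_filter, if_pos this]
    rw [Finset.prod_congr rfl hcount,
      ← Finset.prod_insert (f := fun k => (p.parts.count k)!) h1]
    refine Finset.prod_subset (fun k hk => ?_) fun k _ hk => ?_
    · have := p.parts_pos (Multiset.mem_toFinset.1 hk)
      rw [Multiset.mem_toFinset] at hk
      simp only [Finset.mem_insert, Multiset.mem_toFinset, hm, Multiset.mem_filter, hk, true_and]
      omega
    · rw [Multiset.count_eq_zero.2 (by simpa using hk), Nat.factorial_zero]
  rw [hprod, hfact, show Fintype.card α - m.sum = p.parts.count 1 by omega]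
  ring

/-- The weight `θ ^ |s| / (∏_{a ∈ s} a * ∏_k c_k!)` of a multiset `s` in which `k` occurs `c_k`
times, that is `∏_k (θ / k) ^ c_k / c_k!`. -/
noncomputable def cycleWeight (θ : ℝ) (s : Multiset ℕ) : ℝ :=
  θ ^ Multiset.card s / ((s.prod : ℝ) * ∏ k ∈ s.toFinset, ((s.count k)! : ℝ))

/-- The sum of a function `F` of partitions over the partitions of `n`, weighted by
`cycleWeight`. -/
noncomputable def partitionSum (θ : ℝ) (n : ℕ) (F : Multiset ℕ → ℝ) : ℝ :=
  ∑ p : n.Partition, cycleWeight θ p.parts * F p.parts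

lemma sum_perm_eq_factorial_mul_partitionSum (θ : ℝ) (n : ℕ) (F : Multiset ℕ → ℝ) :
    ∑ σ : Equiv.Perm (Fin n), θ ^ numCycles σ * F σ.partition.parts =
      n ! * partitionSum θ n F := by
  have key : ∑ σ : Equiv.Perm (Fin n), θ ^ numCycles σ * F σ.partition.parts =
      (Fintype.card (Fin n))! * partitionSum θ (Fintype.card (Fin n)) F := by
    rw [← Finset.sum_fiberwise (g := fun σ : Equiv.Perm (Fin n) => σ.partition), partitionSum,
      Finset.mul_sum]
    refine Finset.sum_congr rfl fun p _ => ?_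
    have hpos : ((p.parts.prod : ℝ) * ∏ k ∈ p.parts.toFinset, ((p.parts.count k)! : ℝ)) ≠ 0 := by
      refine mul_ne_zero ?_ (Finset.prod_ne_zero_iff.2 fun k _ => by positivity)
      exact_mod_cast (Multiset.prod_pos fun a ha => p.parts_pos ha).ne'
    rw [Finset.sum_congr rfl (g := fun _ => θ ^ Multiset.card p.parts * F p.parts) (by
      intro σ hσ
      rw [← (Finset.mem_filter.1 hσ).2, numCycles]), Finset.sum_const, nsmul_eq_mul, cycleWeight,
      ← card_partition_eq_mul p]
    simp only [Nat.cast_mul, Nat.cast_prod]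
    generalize (p.parts.prod : ℝ) * ∏ k ∈ p.parts.toFinset, ((p.parts.count k)! : ℝ) = b at hpos ⊢
    field_simp
  simpa using key

lemma partitionSum_one (θ : ℝ) (n : ℕ) :
    partitionSum θ n 1 = (ascPochhammer ℝ n).eval θ / n ! := by
  have := sum_perm_eq_factorial_mul_partitionSum θ n 1
  simp only [Pi.one_apply, mul_one] at this
  rw [sum_pow_numCycles] at this
  rw [this, mul_div_cancel_left₀ _ (by positivity)]

lemma partitionSum_one_pos {θ : ℝ} (hθ : 0 < θ) (n : ℕ) : 0 < partitionSum θ n 1 := by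
  rw [partitionSum_one]
  exact div_pos (ascPochhammer_pos n θ hθ) (by positivity)

/-! ### Removing a cycle -/

lemma cycleWeight_cons (θ : ℝ) {j : ℕ} (hj : 0 < j) (s : Multiset ℕ) :
    cycleWeight θ (j ::ₘ s) * (s.count j + 1) = θ / j * cycleWeight θ s := by
  have hprod : ∏ k ∈ (j ::ₘ s).toFinset, (((j ::ₘ s).count k)! : ℝ) =
      (s.count j + 1) * ∏ k ∈ s.toFinset, ((s.count k)! : ℝ) := by
    have h1 : ∏ k ∈ s.toFinset, ((s.count k)! : ℝ) =
        ∏ k ∈ insert j s.toFinset, ((s.count k)! : ℝ) :=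
      Finset.prod_subset (Finset.subset_insert _ _) fun k _ hk => by
        rw [Multiset.count_eq_zero.2 (by simpa using hk)]; simp
    rw [h1, Multiset.toFinset_cons,
      ← Finset.mul_prod_erase _ _ (Finset.mem_insert_self j s.toFinset),
      ← Finset.mul_prod_erase _ (fun k => ((s.count k)! : ℝ))
        (Finset.mem_insert_self j s.toFinset), ← mul_assoc]
    congr 1
    · rw [Multiset.count_cons_self, Nat.factorial_succ]; push_cast; ring
    · refine Finset.prod_congr rfl fun k hk => ?_
      rw [Multiset.count_cons_of_ne (Finset.ne_of_mem_erase hk)]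
  have hc : (s.count j : ℝ) + 1 ≠ 0 := by positivity
  have hj' : (j : ℝ) ≠ 0 := by positivity
  rw [cycleWeight, cycleWeight, hprod, Multiset.card_cons, Multiset.prod_cons, pow_succ,
    div_mul_eq_mul_div, div_mul_div_comm, mul_comm θ,
    Nat.cast_mul]
  rw [show (j : ℝ) * s.prod * (((s.count j : ℝ) + 1) * ∏ k ∈ s.toFinset, ((s.count k)! : ℝ)) =
    (j * (s.prod * ∏ k ∈ s.toFinset, ((s.count k)! : ℝ))) * ((s.count j : ℝ) + 1) by ring,
    mul_div_mul_right _ _ hc]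

/-- Removing one part `j` is a bijection from the partitions of `n` with a part `j` onto the
partitions of `n - j`. -/
lemma partitionSum_count_mul (θ : ℝ) {j n : ℕ} (hj : 0 < j) (hn : j ≤ n)
    (F : Multiset ℕ → ℝ) :
    partitionSum θ n (fun s => s.count j * F s) =
      θ / j * partitionSum θ (n - j) (fun s => F (j ::ₘ s)) := by
  classical
  rw [partitionSum, partitionSum, ← Finset.sum_filter_of_ne (p := fun p => j ∈ p.parts) (by
    intro p _ h
    by_contra hp
    simp [hp] at h), ← Finset.sum_subtype_eq_sum_filter, Finset.subtype_univ,
    ← (Nat.Partition.partitionWithPartEquiv hj hn).symm.sum_comp, Finset.mul_sum]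
  refine Finset.sum_congr rfl fun q _ => ?_
  rw [Nat.Partition.partitionWithPartEquiv_symm_apply_parts, ← mul_assoc, ← mul_assoc,
    ← cycleWeight_cons θ hj]
  simp

lemma partitionSum_count_mul_of_lt (θ : ℝ) {j n : ℕ} (hn : n < j) (F : Multiset ℕ → ℝ) :
    partitionSum θ n (fun s => s.count j * F s) = 0 := by
  refine Finset.sum_eq_zero fun p _ => ?_
  have : j ∉ p.parts := fun h => by have := p.le_of_mem_parts h; omega
  simp [this]

/-- Weighted factorial moments: each factor of the falling factorial of the number of parts equal
to `j` removes one part `j` and contributes `θ / j`. -/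
lemma partitionSum_descFactorial_mul (θ : ℝ) {j : ℕ} (hj : 0 < j) {G : Multiset ℕ → ℝ}
    (hG : ∀ s, G (j ::ₘ s) = G s) (r n : ℕ) :
    partitionSum θ n (fun s => (s.count j).descFactorial r * G s) =
      if j * r ≤ n then (θ / j) ^ r * partitionSum θ (n - j * r) G else 0 := by
  induction r generalizing n with
  | zero => simp
  | succ r ih =>
    have hF : (fun s : Multiset ℕ => ((s.count j).descFactorial (r + 1) : ℝ) * G s) =
        fun s => s.count j * (((s.count j - 1).descFactorial r : ℝ) * G s) := by
      ext s
      rcases Nat.eq_zero_or_pos (s.count j) with h | h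
      · simp [h]
      · obtain ⟨c, hc⟩ := Nat.exists_eq_succ_of_ne_zero h.ne'
        rw [hc, Nat.succ_eq_add_one, Nat.succ_descFactorial_succ]
        push_cast
        simp [mul_assoc]
    rw [hF]
    rcases lt_or_ge n j with h | h
    · rw [partitionSum_count_mul_of_lt θ h, if_neg]
      have : j * 1 ≤ j * (r + 1) := Nat.mul_le_mul_left j (by omega)
      omega
    · rw [partitionSum_count_mul θ hj h]
      simp only [Multiset.count_cons_self, Nat.add_sub_cancel, hG]
      rw [ih, Nat.mul_succ]
      by_cases h' : j * r + j ≤ n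
      · rw [if_pos (by omega), if_pos h', pow_succ', mul_assoc,
          show n - j - j * r = n - (j * r + j) by omega]
      · rw [if_neg (by omega), if_neg h', mul_zero]

/-! ### Ewens averages -/

/-- The mean of `F` evaluated at the multiset of cycle lengths under the Ewens distribution on
`S_n`, written as a weighted average over the partitions of `n`. -/
noncomputable def ewensMean (θ : ℝ) (n : ℕ) (F : Multiset ℕ → ℝ) : ℝ :=
  partitionSum θ n F / partitionSum θ n 1

lemma integral_ewens {θ : ℝ} (hθ : 0 < θ) (n : ℕ) (F : Multiset ℕ → ℝ) :
    ∫ σ : Equiv.Perm (Fin n), F σ.partition.parts ∂(ewens θ hθ n).toMeasure =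
      ewensMean θ n F := by
  have hpos := ascPochhammer_pos n θ hθ
  rw [PMF.integral_eq_sum, ewensMean, partitionSum_one, div_div_eq_mul_div,
    mul_comm (partitionSum _ _ _), ← sum_perm_eq_factorial_mul_partitionSum, Finset.sum_div]
  refine Finset.sum_congr rfl fun σ _ => ?_
  rw [ewens, PMF.ofFintype_apply, ENNReal.toReal_ofReal (by positivity), smul_eq_mul]
  ring

/-! ### Comparison of the normalizing constants -/

lemma partitionSum_one_succ (θ : ℝ) (n : ℕ) :
    partitionSum θ (n + 1) 1 = partitionSum θ n 1 * ((θ + n) / (n + 1)) := by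
  rw [partitionSum_one, partitionSum_one, ascPochhammer_succ_eval, Nat.factorial_succ]
  push_cast
  field_simp

lemma tendsto_partitionSum_one_ratio {θ : ℝ} (hθ : 0 < θ) (R : ℕ) :
    Tendsto (fun n => partitionSum θ (n - R) 1 / partitionSum θ n 1) atTop (𝓝 1) := by
  induction R with
  | zero =>
    refine tendsto_const_nhds.congr fun n => ?_
    rw [Nat.sub_zero, div_self (partitionSum_one_pos hθ n).ne']
  | succ R ih =>
    rw [← tendsto_add_atTop_iff_nat 1]
    have hstep : Tendsto (fun n : ℕ => ((n : ℝ) + 1) / (n + θ)) atTop (𝓝 1) := by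
      have h : Tendsto (fun n : ℕ => 1 + (1 - θ) / ((n : ℝ) + θ)) atTop (𝓝 (1 + 0)) :=
        tendsto_const_nhds.add (tendsto_const_nhds.div_atTop
          (tendsto_atTop_add_const_right _ _ tendsto_natCast_atTop_atTop))
      rw [add_zero] at h
      refine h.congr fun n => ?_
      have : (n : ℝ) + θ ≠ 0 := by positivity
      field_simp
      ring
    have := ih.mul hstep
    rw [mul_one] at this
    refine this.congr fun n => ?_
    have h1 : (n : ℝ) + θ ≠ 0 := by positivity
    have h2 := (partitionSum_one_pos hθ n).ne'
    rw [partitionSum_one_succ, show n + 1 - (R + 1) = n - R by omega, add_comm θ]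
    field_simp

/-- For `θ < 1` the ratio is not bounded uniformly in `R ≤ n`, but it grows at most geometrically
in `R`, which the factorials in the factorial moment expansions absorb. -/
lemma partitionSum_one_ratio_le {θ : ℝ} (hθ : 0 < θ) {R n : ℕ} (hR : R ≤ n) :
    partitionSum θ (n - R) 1 / partitionSum θ n 1 ≤ max 1 θ⁻¹ ^ R := by
  rw [div_le_iff₀ (partitionSum_one_pos hθ n)]
  obtain ⟨k, rfl⟩ := Nat.exists_eq_add_of_le hR
  rw [Nat.add_sub_cancel_left]
  clear hR
  induction R with
  | zero => simp
  | succ R ih =>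
    refine ih.trans ?_
    rw [show R + 1 + k = R + k + 1 by ring, partitionSum_one_succ, pow_succ]
    have hpos := partitionSum_one_pos hθ (R + k)
    have hK : (1 : ℝ) ≤ max 1 θ⁻¹ * ((θ + (R + k : ℕ)) / ((R + k : ℕ) + 1)) := by
      rw [← mul_div_assoc, one_le_div (by positivity), mul_add, add_comm]
      have h1 : (1 : ℝ) ≤ max 1 θ⁻¹ * θ := by
        rw [← inv_mul_cancel₀ hθ.ne']
        exact mul_le_mul_of_nonneg_right (le_max_right _ _) hθ.le
      exact add_le_add h1 (le_mul_of_one_le_left (by positivity) (le_max_left _ _))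
    calc _ ≤ max 1 θ⁻¹ ^ R * partitionSum θ (R + k) 1 *
          (max 1 θ⁻¹ * ((θ + (R + k : ℕ)) / ((R + k : ℕ) + 1))) :=
        le_mul_of_one_le_right (by positivity) hK
      _ = _ := by ring

/-! ### Adjoining one cycle count -/

lemma ewensMean_one {θ : ℝ} (hθ : 0 < θ) (n : ℕ) : ewensMean θ n 1 = 1 :=
  div_self (partitionSum_one_pos hθ n).ne'

/-- Each factor of the falling factorial removes a cycle of length `j`, which lowers the size of the
symmetric group by `j`. -/
lemma ewensMean_descFactorial_mul {θ : ℝ} (hθ : 0 < θ) {j : ℕ} (hj : 0 < j)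
    {G : Multiset ℕ → ℝ} (hG : ∀ s, G (j ::ₘ s) = G s) (r n : ℕ) :
    ewensMean θ n (fun s => (s.count j).descFactorial r * G s) =
      if j * r ≤ n then (θ / j) ^ r * (partitionSum θ (n - j * r) 1 / partitionSum θ n 1) *
        ewensMean θ (n - j * r) G else 0 := by
  rw [ewensMean, partitionSum_descFactorial_mul θ hj hG]
  split_ifs
  · have h1 := (partitionSum_one_pos hθ n).ne'
    have h2 := (partitionSum_one_pos hθ (n - j * r)).ne'
    rw [ewensMean]
    field_simp
  · simp

lemma ewensMean_finset_sum (θ : ℝ) (n : ℕ) {ι : Type*} (t : Finset ι)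
    (F : ι → Multiset ℕ → ℝ) :
    ewensMean θ n (fun s => ∑ i ∈ t, F i s) = ∑ i ∈ t, ewensMean θ n (F i) := by
  simp only [ewensMean, partitionSum, Finset.mul_sum, ← Finset.sum_div]
  rw [Finset.sum_comm]

lemma ewensMean_const_mul (θ : ℝ) (n : ℕ) (c : ℝ) (F : Multiset ℕ → ℝ) :
    ewensMean θ n (fun s => c * F s) = c * ewensMean θ n F := by
  rw [ewensMean, ewensMean, mul_div_assoc', partitionSum, partitionSum.eq_def θ n F, Finset.mul_sum]
  simp only [mul_left_comm]

lemma ewensMean_congr {θ : ℝ} {n : ℕ} {F F' : Multiset ℕ → ℝ}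
    (h : ∀ p : n.Partition, F p.parts = F' p.parts) : ewensMean θ n F = ewensMean θ n F' := by
  simp only [ewensMean, partitionSum, h]

/-- `a` is the sequence of coefficients of `f` in the basis of falling factorials, and it decays
faster than any geometric sequence. -/
structure IsNewtonExpansion (f a : ℕ → ℝ) : Prop where
  eq_sum : ∀ c, f c = ∑ r ∈ Finset.range (c + 1), a r * c.descFactorial r
  summable : ∀ x : ℝ, 0 ≤ x → Summable fun r => |a r| * x ^ r

/-- If the mean of `G`, which ignores cycles of length `j`, converges to `L`, then the mean of
`f (C_j) * G` converges to `L` times the Poisson mean of `f`. The factorial moment expansion of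
`f (C_j)` is passed to the limit term by term, dominated by a convergent power series. -/
lemma tendsto_ewensMean_mul {θ : ℝ} (hθ : 0 < θ) {j : ℕ} (hj : 0 < j) {G : Multiset ℕ → ℝ}
    (hG : ∀ s, G (j ::ₘ s) = G s) {L : ℝ} (hL : Tendsto (fun n => ewensMean θ n G) atTop (𝓝 L))
    {f a : ℕ → ℝ} (hf : IsNewtonExpansion f a) :
    Tendsto (fun n => ewensMean θ n fun s => f (s.count j) * G s) atTop
      (𝓝 ((∑' r, a r * (θ / j) ^ r) * L)) := by
  obtain ⟨B, hB⟩ : ∃ B, ∀ n, |ewensMean θ n G| ≤ B := by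
    obtain ⟨B, hB⟩ := hL.abs.bddAbove_range
    exact ⟨B, fun n => hB ⟨n, rfl⟩⟩
  have hB0 : 0 ≤ B := (abs_nonneg _).trans (hB 0)
  set K : ℝ := max 1 θ⁻¹
  have hK0 : 0 ≤ K := zero_le_one.trans (le_max_left _ _)
  have hexp : ∀ n, ewensMean θ n (fun s => f (s.count j) * G s) =
      ∑' r, a r * ewensMean θ n (fun s => (s.count j).descFactorial r * G s) := fun n => by
    rw [tsum_eq_sum (s := Finset.range (n + 1)) fun r hr => by
      -- a part `j ≥ 1` occurs at most `n` times in a partition of `n`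
      have hr' : n < r := by simpa using hr
      have : r ≤ j * r := Nat.le_mul_of_pos_left r hj
      rw [ewensMean_descFactorial_mul hθ hj hG, if_neg (by omega), mul_zero]]
    simp only [← ewensMean_const_mul]
    rw [← ewensMean_finset_sum]
    refine ewensMean_congr fun p => ?_
    have hc : p.parts.count j ≤ n := by
      have h1 : Multiset.card p.parts ≤ p.parts.sum := by
        simpa using Multiset.card_nsmul_le_sum (a := 1) fun x hx => p.parts_pos hx
      rw [p.parts_sum] at h1
      exact (Multiset.count_le_card _ _).trans h1
    rw [hf.eq_sum, Finset.sum_mul]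
    refine Finset.sum_subset_zero_on_sdiff (Finset.range_mono (by omega)) (fun r hr => ?_)
      fun r _ => by ring
    have : p.parts.count j < r := by
      have := (Finset.mem_sdiff.1 hr).2
      simpa using this
    rw [Nat.descFactorial_eq_zero_iff_lt.2 this]
    simp
  simp only [hexp]
  rw [← tsum_mul_right]
  refine tendsto_tsum_of_dominated_convergence
    (bound := fun r => |a r| * (θ / j * K ^ j) ^ r * B)
    ((hf.summable _ (by positivity)).mul_right B) (fun r => ?_) (.of_forall fun n r => ?_)
  · rw [mul_assoc]
    refine Tendsto.const_mul _ ?_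
    have h1 := ((tendsto_partitionSum_one_ratio hθ (j * r)).const_mul ((θ / j) ^ r)).mul
      (hL.comp (tendsto_sub_atTop_nat (j * r)))
    rw [mul_one] at h1
    refine h1.congr' ?_
    filter_upwards [eventually_ge_atTop (j * r)] with n hn
    rw [ewensMean_descFactorial_mul hθ hj hG, if_pos hn, Function.comp_apply]
  · rw [ewensMean_descFactorial_mul hθ hj hG, Real.norm_eq_abs, abs_mul, mul_assoc |a r|]
    refine mul_le_mul_of_nonneg_left ?_ (abs_nonneg _)
    split_ifs with h
    · have hq : 0 ≤ partitionSum θ (n - j * r) 1 / partitionSum θ n 1 :=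
        div_nonneg (partitionSum_one_pos hθ _).le (partitionSum_one_pos hθ _).le
      rw [abs_mul, abs_of_nonneg (by positivity), mul_pow, ← pow_mul]
      gcongr
      · exact partitionSum_one_ratio_le hθ h
      · exact hB _
    · rw [abs_zero]
      positivity

/-- Induction on `m`: the product over `k ≤ m` ignores cycles of length `m + 1`, so the next factor
can be adjoined. -/
lemma tendsto_ewensMean_prod {θ : ℝ} (hθ : 0 < θ) {f a : ℕ → ℕ → ℝ}
    (hf : ∀ k, IsNewtonExpansion (f k) (a k)) (m : ℕ) :
    Tendsto (fun n => ewensMean θ n fun s => ∏ k ∈ Finset.Icc 1 m, f k (s.count k)) atTop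
      (𝓝 (∏ k ∈ Finset.Icc 1 m, ∑' r, a k r * (θ / k) ^ r)) := by
  induction m with
  | zero =>
    have h : ∀ n, ewensMean θ n (fun _ => 1) = 1 := ewensMean_one hθ
    simp [h]
  | succ m ih =>
    have hnot : ∀ k ∈ Finset.Icc 1 m, k ≠ m + 1 := fun k hk => by
      have := (Finset.mem_Icc.1 hk).2
      omega
    have := tendsto_ewensMean_mul hθ m.succ_pos (fun s => Finset.prod_congr rfl fun k hk => by
      rw [Multiset.count_cons_of_ne (hnot k hk)]) ih (hf (m + 1))
    simp only [← Finset.insert_Icc_right_eq_Icc_add_one (show 1 ≤ m + 1 by omega)]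
    simp only [Finset.prod_insert (show m + 1 ∉ Finset.Icc 1 m by simp)]
    exact this

/-! ### Expansions in falling factorials -/

lemma pow_eq_sum_stirlingSecond_mul_descFactorial (c p : ℕ) :
    c ^ p = ∑ r ∈ Finset.range (p + 1), Nat.stirlingSecond p r * c.descFactorial r := by
  induction p with
  | zero => simp
  | succ p ih =>
    have hstep : ∀ r, c * c.descFactorial r = c.descFactorial (r + 1) + r * c.descFactorial r := by
      intro r
      rw [Nat.descFactorial_succ]
      rcases le_or_gt r c with h | h
      · rw [← add_mul, Nat.sub_add_cancel h]
      · simp [Nat.descFactorial_eq_zero_iff_lt.2 h]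
    have hshift : ∑ r ∈ Finset.range (p + 1), Nat.stirlingSecond p r * (r * c.descFactorial r) =
        ∑ r ∈ Finset.range (p + 1),
          Nat.stirlingSecond p (r + 1) * ((r + 1) * c.descFactorial (r + 1)) := by
      have h := Finset.sum_range_succ'
        (fun r => Nat.stirlingSecond p r * (r * c.descFactorial r)) (p + 1)
      rw [Finset.sum_range_succ, Nat.stirlingSecond_eq_zero_of_lt (Nat.lt_succ_self p)] at h
      simpa using h
    rw [pow_succ, ih, Finset.sum_mul, Finset.sum_range_succ' _ (p + 1)]
    simp only [Nat.stirlingSecond_succ_succ, Nat.stirlingSecond_succ_zero, zero_mul, add_zero]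
    calc _ = ∑ r ∈ Finset.range (p + 1), Nat.stirlingSecond p r * c.descFactorial (r + 1) +
          ∑ r ∈ Finset.range (p + 1), Nat.stirlingSecond p r * (r * c.descFactorial r) := by
          rw [← Finset.sum_add_distrib]
          refine Finset.sum_congr rfl fun r _ => ?_
          rw [mul_assoc, mul_comm (c.descFactorial r), hstep]
          ring
      _ = _ := by
          rw [hshift, ← Finset.sum_add_distrib]
          refine Finset.sum_congr rfl fun r _ => ?_
          ring

lemma isNewtonExpansion_pow (p : ℕ) :
    IsNewtonExpansion (fun c => (c : ℝ) ^ p) (fun r => Nat.stirlingSecond p r) where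
  eq_sum c := by
    have h1 : (c : ℝ) ^ p =
        ∑ r ∈ Finset.range (p + 1), (Nat.stirlingSecond p r : ℝ) * c.descFactorial r := by
      exact_mod_cast pow_eq_sum_stirlingSecond_mul_descFactorial c p
    have h2 : ∀ N, min p c ≤ N →
        ∑ r ∈ Finset.range (N + 1), (Nat.stirlingSecond p r : ℝ) * c.descFactorial r =
        ∑ r ∈ Finset.range (min p c + 1), (Nat.stirlingSecond p r : ℝ) * c.descFactorial r := by
      intro N hN
      refine (Finset.sum_subset (Finset.range_mono (by omega)) fun r _ hr => ?_).symm
      have hr' : min p c < r := by rw [Finset.mem_range] at hr; omega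
      rcases min_lt_iff.1 hr' with h | h
      · simp [Nat.stirlingSecond_eq_zero_of_lt h]
      · simp [Nat.descFactorial_eq_zero_iff_lt.2 h]
    rw [h1, h2 p (min_le_left _ _), h2 c (min_le_right _ _)]
  summable x _ := by
    refine summable_of_ne_finset_zero (s := Finset.range (p + 1)) fun r hr => ?_
    have : p < r := by simpa using hr
    simp [Nat.stirlingSecond_eq_zero_of_lt this]

lemma tsum_stirlingSecond_mul_pow (p : ℕ) (x : ℝ) :
    ∑' r, (Nat.stirlingSecond p r : ℝ) * x ^ r = (touchard p).eval x := by
  rw [tsum_eq_sum (s := Finset.range (p + 1)) fun r hr => by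
    have : p < r := by simpa using hr
    simp [Nat.stirlingSecond_eq_zero_of_lt this]]
  simp [touchard, Polynomial.eval_finsetSum]

/-- The coefficients of the indicator function of `{j}` in the basis of falling factorials. -/
noncomputable def indicatorCoeff (j r : ℕ) : ℝ :=
  if j ≤ r then (-1) ^ (r - j) / ((j)! * (r - j)!) else 0

lemma hasSum_indicatorCoeff_mul_pow (j : ℕ) (x : ℝ) :
    HasSum (fun r => indicatorCoeff j r * x ^ r) (Real.exp (-x) * x ^ j / j !) := by
  have hexp : HasSum (fun r : ℕ => (-x) ^ r / r !) (Real.exp (-x)) := by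
    rw [Real.exp_eq_exp_ℝ]
    exact NormedSpace.expSeries_div_hasSum_exp (-x)
  rw [← hasSum_nat_add_iff' j, Finset.sum_eq_zero fun r hr => by
    rw [indicatorCoeff, if_neg (by simpa using hr), zero_mul], sub_zero, mul_div_assoc]
  refine (hexp.mul_right (x ^ j / j !)).congr_fun fun r => ?_
  rw [indicatorCoeff, if_pos (Nat.le_add_left j r), Nat.add_sub_cancel, neg_pow x, pow_add]
  field_simp

lemma abs_indicatorCoeff_mul_pow (j r : ℕ) {x : ℝ} (hx : 0 ≤ x) :
    |indicatorCoeff j r| * x ^ r = |indicatorCoeff j r * (-x) ^ r| := by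
  rw [abs_mul, abs_pow, abs_neg, abs_of_nonneg hx]

lemma isNewtonExpansion_indicator (j : ℕ) :
    IsNewtonExpansion (fun c => if c = j then 1 else 0) (indicatorCoeff j) where
  eq_sum c := by
    rcases lt_or_ge c j with h | h
    · rw [if_neg (by omega), Finset.sum_eq_zero fun r hr => ?_]
      have : r < c + 1 := by simpa using hr
      rw [indicatorCoeff, if_neg (by omega), zero_mul]
    · obtain ⟨d, rfl⟩ := Nat.exists_eq_add_of_le h
      -- `a_r (c)_r = (-1) ^ (r - j) * choose c j * choose (c - j) (r - j)`, an alternating sum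
      have hterm : ∀ r ∈ Finset.range (d + 1),
          indicatorCoeff j (j + r) * ((j + d).descFactorial (j + r) : ℝ) =
            ((j + d).choose j : ℝ) * ((-1) ^ r * (d.choose r : ℝ)) := by
        intro r hr
        have hr' : r ≤ d := by simpa [Nat.lt_succ_iff] using hr
        rw [indicatorCoeff, if_pos (Nat.le_add_right j r), Nat.add_sub_cancel_left]
        rw [Nat.cast_choose ℝ h, Nat.cast_choose ℝ hr', Nat.add_sub_cancel_left]
        have hd : ((d - r)! : ℝ) * ((j + d).descFactorial (j + r) : ℝ) = (j + d)! := by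
          have := Nat.factorial_mul_descFactorial (show j + r ≤ j + d by omega)
          rw [Nat.add_sub_add_left] at this
          exact_mod_cast this
        rw [← hd]
        field_simp
      rw [add_assoc, Finset.sum_range_add, Finset.sum_eq_zero fun r hr => by
        rw [indicatorCoeff, if_neg (by simpa using hr), zero_mul], zero_add,
        Finset.sum_congr rfl hterm, ← Finset.mul_sum]
      have halt : ∑ r ∈ Finset.range (d + 1), (-1 : ℝ) ^ r * (d.choose r : ℝ) =
          if d = 0 then 1 else 0 := by
        exact_mod_cast Int.alternating_sum_range_choose (n := d)
      rw [halt]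
      by_cases hd : d = 0
      · simp [hd]
      · simp [hd]
  summable x hx := by
    simp only [abs_indicatorCoeff_mul_pow j _ hx]
    exact (hasSum_indicatorCoeff_mul_pow j (-x)).summable.abs

/-! ### Cylinder sets and weak convergence -/

/-- The set of sequences whose entries of index at most `m` agree with `j`. -/
def initialCylinder (m : ℕ) (j : ℕ+ → ℕ) : Set (ℕ+ → ℕ) :=
  {x | ∀ k : ℕ+, (k : ℕ) ≤ m → x k = j k}

lemma isOpen_initialCylinder (m : ℕ) (j : ℕ+ → ℕ) : IsOpen (initialCylinder m j) := by
  have hfin : {k : ℕ+ | (k : ℕ) ≤ m}.Finite :=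
    Set.Finite.of_injOn (f := fun k : ℕ+ => (k : ℕ)) (t := Set.Iic m) (fun k hk => hk)
      PNat.coe_injective.injOn (Set.finite_Iic m)
  have : initialCylinder m j = ⋂ k ∈ {k : ℕ+ | (k : ℕ) ≤ m}, {x | x k = j k} := by
    ext x; simp [initialCylinder]
  rw [this]
  exact hfin.isOpen_biInter fun k _ => (isOpen_discrete ({j k} : Set ℕ)).preimage
    (f := fun x : ℕ+ → ℕ => x k) (continuous_apply k)

lemma initialCylinder_eq_of_mem {m : ℕ} {j x : ℕ+ → ℕ} (hx : x ∈ initialCylinder m j) :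
    initialCylinder m j = initialCylinder m x := by
  ext y
  exact forall₂_congr fun k hk => by rw [hx k hk]

lemma initialCylinder_anti {m m' : ℕ} (h : m ≤ m') (j : ℕ+ → ℕ) :
    initialCylinder m' j ⊆ initialCylinder m j :=
  fun _ hx k hk => hx k (hk.trans h)

lemma isPiSystem_initialCylinder :
    IsPiSystem {s | ∃ m j, s = initialCylinder m j} := by
  rintro _ ⟨m, j, rfl⟩ _ ⟨m', j', rfl⟩ ⟨x, hx, hx'⟩
  rw [initialCylinder_eq_of_mem hx, initialCylinder_eq_of_mem hx']
  rcases le_total m m' with h | h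
  · exact ⟨m', x, Set.inter_eq_right.2 (initialCylinder_anti h x)⟩
  · exact ⟨m, x, Set.inter_eq_left.2 (initialCylinder_anti h x)⟩

lemma exists_initialCylinder_subset {u : Set (ℕ+ → ℕ)} (hu : IsOpen u) {x : ℕ+ → ℕ}
    (hx : x ∈ u) : ∃ m, initialCylinder m x ⊆ u := by
  obtain ⟨I, t, ht, hsub⟩ := isOpen_pi_iff.1 hu x hx
  refine ⟨I.sup fun k => (k : ℕ), fun y hy => hsub fun k hk => ?_⟩
  rw [hy k (Finset.le_sup (f := fun k : ℕ+ => (k : ℕ)) hk)]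
  exact (ht k hk).2

/-- Weak convergence of probability measures on the sequence space follows from convergence of
the masses of the cylinders. -/
lemma tendsto_of_tendsto_initialCylinder {μ : ℕ → ProbabilityMeasure (ℕ+ → ℕ)}
    {ν : ProbabilityMeasure (ℕ+ → ℕ)}
    (h : ∀ m j, Tendsto (fun n => (μ n : Measure (ℕ+ → ℕ)).real (initialCylinder m j)) atTop
      (𝓝 ((ν : Measure (ℕ+ → ℕ)).real (initialCylinder m j)))) :
    Tendsto μ atTop (𝓝 ν) := by
  refine isPiSystem_initialCylinder.tendsto_probabilityMeasure_of_tendsto_of_mem ?_ ?_ ?_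
  · rintro _ ⟨m, j, rfl⟩
    exact (isOpen_initialCylinder m j).measurableSet
  · intro u hu x hx
    obtain ⟨m, hm⟩ := exists_initialCylinder_subset hu hx
    exact ⟨_, ⟨m, x, rfl⟩,
      (isOpen_initialCylinder m x).mem_nhds fun _ _ => rfl, hm⟩
  · rintro _ ⟨m, j, rfl⟩
    rw [← NNReal.tendsto_coe]
    exact h m j

lemma toPNat'_coe_of_pos {k : ℕ} (hk : 0 < k) : (k.toPNat' : ℕ) = k := by
  rw [Nat.toPNat'_coe, if_pos hk]

/-- The mass that a sequence of independent Poisson variables gives to a cylinder. -/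
lemma measureReal_initialCylinder_of_iIndepFun {θ : ℝ} (hθ : 0 < θ) {Ω : Type*}
    [MeasurableSpace Ω] {P : Measure Ω} {Z : ℕ+ → Ω → ℕ}
    (hlaw : ∀ m : ℕ+, HasLaw (Z m) (poissonMeasure (θ / (m : ℝ)).toNNReal) P)
    (hind : iIndepFun Z P) (m : ℕ) (j : ℕ+ → ℕ) :
    P.real {ω | (fun k => Z k ω) ∈ initialCylinder m j} =
      ∏ k ∈ Finset.Icc 1 m,
        Real.exp (-(θ / k)) * (θ / k) ^ j k.toPNat' / ((j k.toPNat')! : ℝ) := by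
  have hset : {ω | (fun k => Z k ω) ∈ initialCylinder m j} =
      ⋂ k ∈ (Finset.Icc 1 m).image Nat.toPNat', Z k ⁻¹' {j k} := by
    ext ω
    simp only [Set.mem_ofPred_eq, initialCylinder, Set.mem_iInter, Set.mem_preimage,
      Set.mem_singleton_iff, Finset.mem_image, Finset.mem_Icc]
    constructor
    · rintro h _ ⟨k, hk, rfl⟩
      exact h _ (by rw [toPNat'_coe_of_pos hk.1]; exact hk.2)
    · exact fun h k hk => h k ⟨k, ⟨k.pos, hk⟩, PNat.coe_toPNat' k⟩
  have hinj : Set.InjOn Nat.toPNat' (Finset.Icc 1 m) := by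
    intro a ha b hb hab
    have := congrArg ((↑) : ℕ+ → ℕ) hab
    rwa [toPNat'_coe_of_pos (Finset.mem_Icc.1 ha).1,
      toPNat'_coe_of_pos (Finset.mem_Icc.1 hb).1] at this
  rw [measureReal_def, hset,
    hind.measure_inter_preimage_eq_mul _ fun _ _ => measurableSet_singleton _,
    Finset.prod_image hinj, ENNReal.toReal_prod]
  refine Finset.prod_congr rfl fun k hk => ?_
  have hk1 : 0 < k := (Finset.mem_Icc.1 hk).1
  have hmass := (hlaw k.toPNat').measureReal_eq (p := (· = j k.toPNat')) (measurableSet_singleton _)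
  rw [toPNat'_coe_of_pos hk1] at hmass
  have hr : ((θ / (k : ℝ)).toNNReal : ℝ) = θ / k := Real.coe_toNNReal _ (by positivity)
  rw [← hr, ← poissonMeasure_real_singleton]
  exact hmass

/-! ### Cycle counts under the Ewens distribution -/

/-- Joint limit law of the cycle counts, tested on products of functions of single counts. -/
lemma tendsto_integral_prod_cycleCount {θ : ℝ} (hθ : 0 < θ) {f a : ℕ → ℕ → ℝ}
    (hf : ∀ k, IsNewtonExpansion (f k) (a k)) (m : ℕ) :
    Tendsto (fun n : ℕ => ∫ σ : Equiv.Perm (Fin n),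
        ∏ k ∈ Finset.Icc 1 m, f k (cycleCount k σ) ∂(ewens θ hθ n).toMeasure) atTop
      (𝓝 (∏ k ∈ Finset.Icc 1 m, ∑' r, a k r * (θ / k) ^ r)) :=
  (tendsto_ewensMean_prod hθ hf m).congr fun n =>
    (integral_ewens hθ n fun s => ∏ k ∈ Finset.Icc 1 m, f k (s.count k)).symm

lemma tendsto_ewens_cycleCount_eq {θ : ℝ} (hθ : 0 < θ) (m : ℕ) (j : ℕ → ℕ) :
    Tendsto (fun n : ℕ => (ewens θ hθ n).toMeasure.real
        {σ | ∀ k ∈ Finset.Icc 1 m, cycleCount k σ = j k}) atTop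
      (𝓝 (∏ k ∈ Finset.Icc 1 m, Real.exp (-(θ / k)) * (θ / k) ^ j k / ((j k)! : ℝ))) := by
  have h := tendsto_integral_prod_cycleCount hθ (fun k => isNewtonExpansion_indicator (j k)) m
  simp only [(hasSum_indicatorCoeff_mul_pow _ _).tsum_eq] at h
  refine h.congr fun n => ?_
  rw [← integral_indicator_one MeasurableSpace.measurableSet_top]
  refine integral_congr_ae (.of_forall fun σ => ?_)
  simp only [Finset.prod_ite_zero, Finset.prod_const_one, Set.indicator_apply, Set.mem_ofPred_eq,
    Pi.one_apply]

end EwensCycles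

/-- Convergence of the cycle counts under the Ewens distribution to independent Poisson
variables: weak convergence in the sequence space `ℕ^∞` (product topology), convergence of the
joint probability mass functions, and convergence of the joint moments. -/
theorem theoremC (θ : ℝ) (hθ : 0 < θ) :
    (∀ (Ω : Type*) [MeasurableSpace Ω] (P : Measure Ω) [IsProbabilityMeasure P]
        (Z : ℕ+ → Ω → ℕ)
        (_ : ∀ m : ℕ+, HasLaw (Z m) (poissonMeasure (θ / (m : ℝ)).toNNReal) P)
        (_ : iIndepFun Z P),
      TendstoInDistribution
        (fun (n : ℕ) (σ : Equiv.Perm (Fin n)) (m : ℕ+) => EwensCycles.cycleCount (m : ℕ) σ)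
        atTop (fun ω m => Z m ω) (fun n => (EwensCycles.ewens θ hθ n).toMeasure) P) ∧
    (∀ (m : ℕ) (j : ℕ → ℕ),
      Tendsto
        (fun n : ℕ => (EwensCycles.ewens θ hθ n).toMeasure.real
          {σ | ∀ k ∈ Finset.Icc 1 m, EwensCycles.cycleCount k σ = j k})
        atTop
        (𝓝 (∏ k ∈ Finset.Icc 1 m,
          Real.exp (-(θ / k)) * (θ / k) ^ j k / (Nat.factorial (j k) : ℝ)))) ∧
    (∀ (m : ℕ) (k : ℕ → ℕ),
      Tendsto
        (fun n : ℕ => ∫ σ : Equiv.Perm (Fin n),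
          ∏ j ∈ Finset.Icc 1 m, (EwensCycles.cycleCount j σ : ℝ) ^ k j
            ∂(EwensCycles.ewens θ hθ n).toMeasure)
        atTop
        (𝓝 (∏ j ∈ Finset.Icc 1 m, (EwensCycles.touchard (k j)).eval (θ / j)))) := by
  refine ⟨fun Ω _ P _ Z hlaw hind => ?_, EwensCycles.tendsto_ewens_cycleCount_eq hθ, fun m k => ?_⟩
  · have hX : ∀ n, Measurable fun (σ : Equiv.Perm (Fin n)) (m : ℕ+) =>
        EwensCycles.cycleCount (m : ℕ) σ := fun n _ _ => MeasurableSpace.measurableSet_top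
    have hZ : AEMeasurable (fun ω m => Z m ω) P := aemeasurable_pi_lambda _ fun m =>
      (hlaw m).aemeasurable
    refine ⟨fun n => (hX n).aemeasurable, hZ,
      EwensCycles.tendsto_of_tendsto_initialCylinder fun m j => ?_⟩
    have hmeas := (EwensCycles.isOpen_initialCylinder m j).measurableSet
    simp only [ProbabilityMeasure.coe_mk]
    rw [map_measureReal_apply_of_aemeasurable hZ hmeas]
    have hlim := EwensCycles.tendsto_ewens_cycleCount_eq hθ m fun k => j k.toPNat'
    rw [← EwensCycles.measureReal_initialCylinder_of_iIndepFun hθ hlaw hind] at hlim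
    refine hlim.congr fun n => ?_
    rw [map_measureReal_apply (hX n) hmeas]
    congr 1
    ext σ
    constructor
    · intro h k hk
      simpa using h k (Finset.mem_Icc.2 ⟨k.pos, hk⟩)
    · intro h k hk
      obtain ⟨h1, h2⟩ := Finset.mem_Icc.1 hk
      have := h k.toPNat' (by rw [EwensCycles.toPNat'_coe_of_pos h1]; exact h2)
      beta_reduce at this
      rwa [EwensCycles.toPNat'_coe_of_pos h1] at this
  · have h := EwensCycles.tendsto_integral_prod_cycleCount hθ
      (fun j => EwensCycles.isNewtonExpansion_pow (k j)) m
    simpa only [EwensCycles.tsum_stirlingSecond_mul_pow] using h
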